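/- Let $K$ be an arbitrary field, let $$R=K[s,t,u,v,x,y]/\big(su^2x^2+tuxvy+sv^2y^2\big),$$ and let $\mathfrak m=(s,t,u,v,x,y)R$. Then $R$ is an integral domain, and $R_{\mathfrak m}$ is a local domain. Let $A$ be any one of the rings $R$, $R_{\mathfrak m}$, $R/(s-1)$, and write $x,y$ also for the images of $x,y$ in $A$. Then: (1) the local cohomology module $H^2_{(x,y)}(A)$ has infinitely many associated prime ideals (as an $A$-module); (2) for every infinite set $\mathbb S$ of positive integers, the set $\bigcup_{m\in\mathbb S}\operatorname{Ass}_A A/(x^m,y^m)A$ is infinite; (3) in particular, if $K$ has characteristic $p>0$, then $\bigcup_{e\in\mathbb N}\operatorname{Ass}_A A/(x^{p^e},y^{p^e})A$ is infinite. -/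

import Mathlib

universe w

namespace DomainExample

/-- The set of associated primes of the local cohomology module `H²_{(x,y)}(A)`. -/
abbrev assH2 {A : Type w} [CommRing A] (x y : A) : Set (Ideal A) :=
  associatedPrimes A ((localCohomology (Ideal.span {x, y}) 2).obj (ModuleCat.of A A))

/-- The set of associated primes of the `A`-module `A/(x^m, y^m)`. -/
abbrev assPow {A : Type w} [CommRing A] (x y : A) (m : ℕ) : Set (Ideal A) :=
  associatedPrimes A (A ⧸ (Ideal.span {x ^ m, y ^ m} : Ideal A))

variable (K : Type w) [Field K]

/-- The polynomial `s u² x² + t u x v y + s v² y²` in `K[s,t,u,v,x,y]`; the variables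
`s, t, u, v, x, y` are `X 0, X 1, X 2, X 3, X 4, X 5`. -/
noncomputable def poly : MvPolynomial (Fin 6) K :=
  let s := MvPolynomial.X 0
  let t := MvPolynomial.X 1
  let u := MvPolynomial.X 2
  let v := MvPolynomial.X 3
  let x := MvPolynomial.X 4
  let y := MvPolynomial.X 5
  s * u ^ 2 * x ^ 2 + t * u * x * v * y + s * v ^ 2 * y ^ 2

/-- `R = K[s,t,u,v,x,y]/(s u² x² + t u x v y + s v² y²)`. -/
abbrev R : Type w := MvPolynomial (Fin 6) K ⧸ (Ideal.span {poly K} : Ideal (MvPolynomial (Fin 6) K))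

/-- The class in `R` of the `i`-th variable. -/
noncomputable abbrev var (i : Fin 6) : R K := Ideal.Quotient.mk _ (MvPolynomial.X i)

noncomputable abbrev s : R K := var K 0
noncomputable abbrev t : R K := var K 1
noncomputable abbrev u : R K := var K 2
noncomputable abbrev v : R K := var K 3
noncomputable abbrev x : R K := var K 4
noncomputable abbrev y : R K := var K 5

/-- The ideal `𝔪 = (s,t,u,v,x,y)R`. -/
noncomputable def maxIdeal : Ideal (R K) := Ideal.span {s K, t K, u K, v K, x K, y K}

/-- Evaluation of (classes of) polynomials at the origin. -/
noncomputable def evalZero : R K →+* K :=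
  Ideal.Quotient.lift _ (MvPolynomial.constantCoeff : MvPolynomial (Fin 6) K →+* K) (by
    intro a ha
    obtain ⟨b, rfl⟩ := Ideal.mem_span_singleton'.1 ha
    simp [poly])

theorem var_mem_maxIdeal (i : Fin 6) : var K i ∈ maxIdeal K := by
  apply Ideal.subset_span
  fin_cases i <;> simp

theorem maxIdeal_eq_ker : maxIdeal K = RingHom.ker (evalZero K) := by
  apply le_antisymm
  · refine Ideal.span_le.2 ?_
    rintro a (rfl | rfl | rfl | rfl | rfl | rfl) <;> simp [evalZero, RingHom.mem_ker]
  · intro a ha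
    obtain ⟨p, rfl⟩ := Ideal.Quotient.mk_surjective a
    have key : ∀ p : MvPolynomial (Fin 6) K,
        (Ideal.Quotient.mk (Ideal.span {poly K}) (p - MvPolynomial.C p.constantCoeff) : R K)
          ∈ maxIdeal K := by
      intro p
      induction p using MvPolynomial.induction_on with
      | C a => simp
      | add p q hp hq =>
        have := Ideal.add_mem _ hp hq
        rw [← map_add] at this
        convert this using 2
        simp only [map_add]
        ring
      | mul_X p i _ =>
        have := Ideal.mul_mem_left (maxIdeal K)
          (Ideal.Quotient.mk (Ideal.span {poly K}) p) (var_mem_maxIdeal K i)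
        simpa using this
    have h0 : MvPolynomial.constantCoeff p = 0 := by
      simpa [evalZero, RingHom.mem_ker] using ha
    simpa [h0] using key p

instance maxIdeal_isPrime : (maxIdeal K).IsPrime := by
  rw [maxIdeal_eq_ker]
  exact RingHom.ker_isPrime _

/-- The specialization `R/(s - 1)`. -/
abbrev Spec1 : Type w := R K ⧸ (Ideal.span {s K - 1} : Ideal (R K))

/-- The localization `R_𝔪`. -/
abbrev Loc : Type w := Localization.AtPrime (maxIdeal K)

/-- The quotient map `R → R/(s - 1)`. -/
noncomputable abbrev toSpec1 : R K →+* Spec1 K := Ideal.Quotient.mk (Ideal.span {s K - 1})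

/-- The localization map `R → R_𝔪`. -/
noncomputable abbrev toLoc : R K →+* Loc K := algebraMap (R K) (Loc K)

end DomainExample

/-! Put X = ux, Y = vy, so that sX² + tXY + sY² = 0, and let d_n = `recSeq s t n`. Modulo Yⁿ the
relation rewrites sⁿ⁻¹Xⁿ as d_n·XYⁿ⁻¹. Hence d_n kills the class of z = XYⁿ⁻¹(xy)^(m-n) in A/(x^m,
y^m) (`recSeq_mul_mem`), whereas no power of s kills it when n ≥ 2. So some associated prime
contains d_n but not s (`exists_associatedPrime`). In a domain where s ≠ 0, d_a = d_b = 0 forces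
d_gcd(a,b) = 0, and d_1 = 1; thus distinct prime indices n give distinct associated primes
(`infinite_of_forall_prime`).

Nonmembership is detected by a linear form. Specialize t to -sμ, with μ in the algebraic closure
chosen so that the sequence c_0 = 0, c_1 = 1, c_(i+2) = μc_(i+1) - c_i satisfies c_n = 0. Weighting
XⁱYⁿ⁻ⁱ(xy)^(m-n) by c_i kills the quadric, x^m and y^m, but not z
(`constantCoeff_specialize_eq_zero`).

For H², a colimit of Ext²(A/Jᵗ, A) with J = (x, y), projective resolutions are compared with Koszul
complexes on powers of x and y, just far enough to turn z into a class killed by d_n and by no power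
of s (`exists_localCohomology_two_torsion`). -/

namespace DomainExample

section LocalCohomology

open CategoryTheory Opposite Limits

/-! ### Maps out of left derived functors, described on a resolution. -/

noncomputable section LeftDerived

universe v u v' u'

variable {C : Type u} [Category.{v} C] {D : Type u'} [Category.{v'} D]
  [Abelian C] [HasProjectiveResolutions C] [Abelian D] (F : C ⥤ D) [F.Additive] {X X' : C}

/-- The morphism out of the homology of a complex induced by a morphism which vanishes on
boundaries. -/
def homologyDesc (K : ChainComplex D ℕ) (n : ℕ) {J : D} (k : K.X n ⟶ J)
    (hk : K.d (n + 1) n ≫ k = 0) : K.homology n ⟶ J :=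
  K.homologyι n ≫ K.descOpcycles k (n + 1) (ChainComplex.prev ℕ n) hk

theorem homologyDesc_comp (K : ChainComplex D ℕ) (n : ℕ) {J J' : D} (k : K.X n ⟶ J)
    (hk : K.d (n + 1) n ≫ k = 0) (j : J ⟶ J') (hk' : K.d (n + 1) n ≫ k ≫ j = 0) :
    homologyDesc K n k hk ≫ j = homologyDesc K n (k ≫ j) hk' := by
  rw [homologyDesc, homologyDesc, Category.assoc]
  congr 1
  rw [← cancel_epi (K.pOpcycles n)]
  simp

/-- Homology is the kernel of opcycles → `K.X n`. A map on opcycles that vanishes on this kernel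
extends to `K.X n` because `J` is injective. -/
theorem homologyDesc_eq_zero_iff (K : ChainComplex D ℕ) (n : ℕ) {J : D} [Injective J]
    (k : K.X (n + 1) ⟶ J) (hk : K.d (n + 1 + 1) (n + 1) ≫ k = 0) :
    homologyDesc K (n + 1) k hk = 0 ↔ ∃ h : K.X n ⟶ J, k = K.d (n + 1) n ≫ h := by
  have hex : (ShortComplex.mk (K.homologyι (n + 1)) (K.fromOpcycles (n + 1) n)
      (K.homologyι_comp_fromOpcycles (n + 1) n)).Exact :=
    ShortComplex.exact_of_f_is_kernel _ (K.homologyIsKernel (n + 1) n (by simp))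
  constructor
  · intro h0
    have hdesc := hex.comp_descToInjective _ h0
    refine ⟨hex.descToInjective _ h0, ?_⟩
    replace hdesc := congrArg (K.pOpcycles (n + 1) ≫ ·) hdesc
    simp only [HomologicalComplex.p_descOpcycles, HomologicalComplex.p_fromOpcycles_assoc] at hdesc
    exact hdesc.symm
  · rintro ⟨h, rfl⟩
    have : K.descOpcycles (K.d (n + 1) n ≫ h) (n + 1 + 1) (ChainComplex.prev ℕ (n + 1)) hk =
        K.fromOpcycles (n + 1) n ≫ h := by
      rw [← cancel_epi (K.pOpcycles (n + 1))]
      simp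
    rw [homologyDesc, this, HomologicalComplex.homologyι_comp_fromOpcycles_assoc, zero_comp]

theorem homologyMap_comp_homologyDesc {K L : ChainComplex D ℕ} (φ : L ⟶ K) (n : ℕ) {J : D}
    (k : K.X n ⟶ J) (hk : K.d (n + 1) n ≫ k = 0) (hk' : L.d (n + 1) n ≫ φ.f n ≫ k = 0) :
    HomologicalComplex.homologyMap φ n ≫ homologyDesc K n k hk =
      homologyDesc L n (φ.f n ≫ k) hk' := by
  rw [homologyDesc, homologyDesc, HomologicalComplex.homologyι_naturality_assoc]
  congr 1
  rw [← cancel_epi (L.pOpcycles n)]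
  simp

/-- The morphism out of a left derived functor induced by a morphism which vanishes on
boundaries. -/
def leftDerivedDesc (P : ProjectiveResolution X) (n : ℕ) {J : D}
    (k : F.obj (P.complex.X n) ⟶ J) (hk : F.map (P.complex.d (n + 1) n) ≫ k = 0) :
    (F.leftDerived n).obj X ⟶ J :=
  (P.isoLeftDerivedObj F n).hom ≫
    homologyDesc ((F.mapHomologicalComplex _).obj P.complex) n k hk

theorem leftDerivedDesc_comp (P : ProjectiveResolution X) (n : ℕ) {J J' : D}
    (k : F.obj (P.complex.X n) ⟶ J) (hk : F.map (P.complex.d (n + 1) n) ≫ k = 0) (j : J ⟶ J')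
    (hk' : F.map (P.complex.d (n + 1) n) ≫ k ≫ j = 0) :
    leftDerivedDesc F P n k hk ≫ j = leftDerivedDesc F P n (k ≫ j) hk' :=
  (Category.assoc _ _ _).trans (congrArg (fun a => _ ≫ a) 
    (homologyDesc_comp ((F.mapHomologicalComplex _).obj P.complex) n k hk j hk'))

theorem leftDerivedDesc_eq_zero_iff (P : ProjectiveResolution X) (n : ℕ) {J : D} [Injective J]
    (k : F.obj (P.complex.X (n + 1)) ⟶ J)
    (hk : F.map (P.complex.d (n + 1 + 1) (n + 1)) ≫ k = 0) :
    leftDerivedDesc F P (n + 1) k hk = 0 ↔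
      ∃ h : F.obj (P.complex.X n) ⟶ J, k = F.map (P.complex.d (n + 1) n) ≫ h := by
  rw [leftDerivedDesc]
  refine Iff.trans ⟨fun h => ?_, fun h => ?_⟩ (homologyDesc_eq_zero_iff
    ((F.mapHomologicalComplex _).obj P.complex) n k hk)
  · exact (cancel_epi (P.isoLeftDerivedObj F (n + 1)).hom).1 (h.trans comp_zero.symm)
  · exact (congrArg (fun a => (P.isoLeftDerivedObj F (n + 1)).hom ≫ a) h).trans comp_zero

theorem leftDerived_map_comp_leftDerivedDesc (P : ProjectiveResolution X)
    (P' : ProjectiveResolution X') (f : X' ⟶ X) (φ : P'.complex ⟶ P.complex)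
    (comm : φ.f 0 ≫ P.π.f 0 = P'.π.f 0 ≫ f) (n : ℕ) {J : D}
    (k : F.obj (P.complex.X n) ⟶ J) (hk : F.map (P.complex.d (n + 1) n) ≫ k = 0)
    (hk' : F.map (P'.complex.d (n + 1) n) ≫ F.map (φ.f n) ≫ k = 0) :
    (F.leftDerived n).map f ≫ leftDerivedDesc F P n k hk =
      leftDerivedDesc F P' n (F.map (φ.f n) ≫ k) hk' := by
  have h₁ := congrArg
    (· ≫ homologyDesc ((F.mapHomologicalComplex _).obj P.complex) n k hk)
    (ProjectiveResolution.isoLeftDerivedObj_hom_naturality f P' P φ comm F n)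
  have h₂ := homologyMap_comp_homologyDesc ((F.mapHomologicalComplex _).map φ) n k hk hk'
  refine (Category.assoc _ _ _).symm.trans (h₁.trans ((Category.assoc _ _ _).trans ?_))
  exact congrArg (fun a => (P'.isoLeftDerivedObj F n).hom ≫ a) h₂

end LeftDerived

/-! ### Cocycles on a projective resolution as elements of Ext. -/

noncomputable section ExtClasses

variable {A : Type w} [CommRing A] {X X' : ModuleCat.{w} A}

/-- A morphism `M ⟶ Y`, seen as a morphism from the free module of rank one to `Hom (M, Y)`. -/
def pointHom {M Y : ModuleCat.{w} A} (g : M ⟶ Y) :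
    (((linearYoneda A (ModuleCat.{w} A)).obj Y).rightOp).obj M ⟶ op (ModuleCat.of A A) :=
  (ModuleCat.ofHom (LinearMap.toSpanSingleton A (M ⟶ Y) g)).op

theorem pointHom_unop_one {M Y : ModuleCat.{w} A} (g : M ⟶ Y) :
    (pointHom g).unop.hom (1 : A) = g :=
  one_smul A g

theorem op_hom_ext {N : (ModuleCat.{w} A)ᵒᵖ} {k k' : N ⟶ op (ModuleCat.of A A)}
    (h : k.unop.hom (1 : A) = k'.unop.hom (1 : A)) : k = k' := by
  apply Quiver.Hom.unop_inj
  apply ModuleCat.hom_ext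
  apply LinearMap.ext_ring
  exact h

theorem pointHom_injective {M Y : ModuleCat.{w} A} {g g' : M ⟶ Y}
    (h : pointHom g = pointHom g') : g = g' := by
  rw [← pointHom_unop_one g, h, pointHom_unop_one]

theorem pointHom_surjective {M Y : ModuleCat.{w} A}
    (k : (((linearYoneda A (ModuleCat.{w} A)).obj Y).rightOp).obj M ⟶ op (ModuleCat.of A A)) :
    ∃ g : M ⟶ Y, pointHom g = k :=
  ⟨k.unop.hom (1 : A), op_hom_ext (pointHom_unop_one _)⟩

theorem map_comp_pointHom {M N Y : ModuleCat.{w} A} (f : M ⟶ N) (g : N ⟶ Y) :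
    (((linearYoneda A (ModuleCat.{w} A)).obj Y).rightOp).map f ≫ pointHom g =
      pointHom (f ≫ g) := by
  apply op_hom_ext
  rw [pointHom_unop_one]
  exact congrArg (f ≫ ·) (pointHom_unop_one g)

theorem pointHom_zero {M Y : ModuleCat.{w} A} : pointHom (0 : M ⟶ Y) = 0 := by
  apply op_hom_ext
  rw [pointHom_unop_one]
  rfl

theorem pointHom_smul {M Y : ModuleCat.{w} A} (r : A) (g : M ⟶ Y) :
    pointHom (r • g) = pointHom g ≫ (r • 𝟙 (ModuleCat.of A A)).op := by
  apply op_hom_ext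
  rw [pointHom_unop_one]
  change r • g = (pointHom g).unop.hom (r • (1 : A))
  rw [map_smul, pointHom_unop_one]
  rfl

theorem map_d_comp_pointHom {M N Y : ModuleCat.{w} A} {d : M ⟶ N} {g : N ⟶ Y} (hg : d ≫ g = 0) :
    (((linearYoneda A (ModuleCat.{w} A)).obj Y).rightOp).map d ≫ pointHom g = 0 := by
  rw [map_comp_pointHom, hg, pointHom_zero]

/-- The class in `Ext` of a cocycle on a projective resolution. -/
def extClass (P : ProjectiveResolution X) (Y : ModuleCat.{w} A) (n : ℕ) (g : P.complex.X n ⟶ Y)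
    (hg : P.complex.d (n + 1) n ≫ g = 0) :
    (((Ext A (ModuleCat.{w} A) n).obj (op X)).obj Y : ModuleCat.{w} A) :=
  (leftDerivedDesc (((linearYoneda A (ModuleCat.{w} A)).obj Y).rightOp) P n (pointHom g)
    (map_d_comp_pointHom hg)).unop.hom (1 : A)

theorem extClass_smul (P : ProjectiveResolution X) (Y : ModuleCat.{w} A) (n : ℕ)
    (g : P.complex.X n ⟶ Y) (hg : P.complex.d (n + 1) n ≫ g = 0) (r : A)
    (hg' : P.complex.d (n + 1) n ≫ (r • g) = 0) :
    extClass P Y n (r • g) hg' = r • extClass P Y n g hg := by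
  have h := map_d_comp_pointHom hg'
  have := leftDerivedDesc_comp _ P n (pointHom g) (map_d_comp_pointHom hg)
    (r • 𝟙 (ModuleCat.of A A)).op (by rwa [← pointHom_smul])
  simp only [← pointHom_smul] at this
  rw [extClass, ← this]
  exact map_smul (leftDerivedDesc (((linearYoneda A (ModuleCat.{w} A)).obj Y).rightOp) P n
    (pointHom g) (map_d_comp_pointHom hg)).unop.hom r (1 : A)

theorem extClass_eq_zero_iff (P : ProjectiveResolution X) (Y : ModuleCat.{w} A) (n : ℕ)
    (g : P.complex.X (n + 1) ⟶ Y) (hg : P.complex.d (n + 1 + 1) (n + 1) ≫ g = 0) :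
    extClass P Y (n + 1) g hg = 0 ↔
      ∃ h : P.complex.X n ⟶ Y, g = P.complex.d (n + 1) n ≫ h := by
  -- Ext is a left derived functor into the opposite category, where the projective module `A`
  -- becomes the injective object required by the vanishing criterion.
  have : Projective (ModuleCat.of A A) := inferInstance
  have key := leftDerivedDesc_eq_zero_iff (((linearYoneda A (ModuleCat.{w} A)).obj Y).rightOp) P n
    (pointHom g) (map_d_comp_pointHom hg)
  constructor
  · intro h
    obtain ⟨k, hk⟩ := key.1 (op_hom_ext h)
    obtain ⟨k, rfl⟩ := pointHom_surjective k
    exact ⟨k, pointHom_injective (hk.trans (map_comp_pointHom _ _))⟩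
  · rintro ⟨k, hk⟩
    rw [extClass, key.2 ⟨pointHom k, by rw [map_comp_pointHom, hk]⟩]
    rfl

theorem extClass_map (P : ProjectiveResolution X) (P' : ProjectiveResolution X') (f : X' ⟶ X)
    (φ : P'.complex ⟶ P.complex) (comm : φ.f 0 ≫ P.π.f 0 = P'.π.f 0 ≫ f)
    (Y : ModuleCat.{w} A) (n : ℕ) (g : P.complex.X n ⟶ Y)
    (hg : P.complex.d (n + 1) n ≫ g = 0) (hg' : P'.complex.d (n + 1) n ≫ φ.f n ≫ g = 0) :
    (((Ext A (ModuleCat.{w} A) n).map f.op).app Y).hom (extClass P Y n g hg) =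
      extClass P' Y n (φ.f n ≫ g) hg' := by
  have h := map_d_comp_pointHom hg'
  rw [← map_comp_pointHom] at h
  have key := leftDerived_map_comp_leftDerivedDesc
    (((linearYoneda A (ModuleCat.{w} A)).obj Y).rightOp) P P' f φ comm n (pointHom g)
    (map_d_comp_pointHom hg) h
  simp only [map_comp_pointHom] at key
  rw [extClass, extClass, ← key]
  rfl

end ExtClasses

/-- Local cohomology is a filtered colimit of Ext modules, so an element that dies in the colimit
already dies at a finite stage. -/
theorem exists_localCohomology_map {A : Type w} [CommRing A] (J : Ideal A) (i : ℕ)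
    (Y : ModuleCat.{w} A) (t : ℕ) :
    ∃ ι : (((Ext A (ModuleCat.{w} A) i).obj (op (ModuleCat.of A (A ⧸ J ^ t)))).obj Y :
        ModuleCat.{w} A) →ₗ[A] ((localCohomology J i).obj Y : ModuleCat.{w} A),
      ∀ η, ι η = 0 → ∃ (t' : ℕ) (h : t ≤ t'),
        (((Ext A (ModuleCat.{w} A) i).map
          (ModuleCat.ofHom (Submodule.mapQ (J ^ t') (J ^ t) LinearMap.id
            (Ideal.pow_le_pow_right h)) :
            ModuleCat.of A (A ⧸ J ^ t') ⟶ ModuleCat.of A (A ⧸ J ^ t)).op).app Y).hom η = 0 := by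
  let D := localCohomology.diagram (localCohomology.idealPowersDiagram J) i
  have := localCohomology.hasColimitDiagram.{w, 0} (localCohomology.idealPowersDiagram J) i
  let E := (evaluation (ModuleCat.{w} A) (ModuleCat.{w} A)).obj Y
  have hc := isColimitOfPreserves E (colimit.isColimit D)
  refine ⟨((colimit.ι D (op (op t))).app Y).hom, fun η hη => ?_⟩
  have : PreservesFilteredColimitsOfSize.{0, 0} (forget (ModuleCat.{w} A)) :=
    preservesFilteredColimitsOfSize_shrink.{0, w, 0, w} _
  obtain ⟨k, f, g, hk⟩ := Concrete.isColimit_exists_of_rep_eq (D ⋙ E) hc (i := op (op t))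
    (j := op (op t)) η 0 (hη.trans (map_zero _).symm)
  refine ⟨k.unop.unop, f.unop.unop.down.down, ?_⟩
  exact hk.trans (map_zero ((D ⋙ E).map g).hom)

/-! ### Comparison of resolutions with Koszul complexes. -/

section Koszul

variable {A : Type*} [CommRing A]

theorem span_pair_pow_le (x y : A) (M : ℕ) :
    Ideal.span {x, y} ^ (M + M) ≤ Ideal.span {x ^ M, y ^ M} := by
  rw [Ideal.span_insert, Ideal.span_insert, ← Ideal.span_singleton_pow,
    ← Ideal.span_singleton_pow]
  exact Ideal.sup_pow_add_le_pow_sup_pow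

/-- Sufficiently far in the tower of Koszul complexes on powers of `x` and `y`, every cycle of
degree one becomes a boundary. -/
theorem exists_koszul_cycle_eq_boundary [IsDomain A] [IsNoetherianRing A] {x y : A} (hx : x ≠ 0)
    (hy : y ≠ 0) (m : ℕ) :
    ∃ k, ∀ a b : A, a * x ^ (k + m) + b * y ^ (k + m) = 0 →
      ∃ c, a * x ^ k = c * y ^ m ∧ b * y ^ k = -(c * x ^ m) := by
  -- `k` is the Artin–Rees constant for the y-adic filtration and (x^m): (y^(k+m)) ∩ (x^m) lies in
  -- y^m(x^m).
  obtain ⟨k, hk⟩ := Ideal.exists_pow_inf_eq_pow_smul (Ideal.span {y})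
    (Ideal.span {x ^ m} : Submodule A A)
  refine ⟨k, fun a b hab => ?_⟩
  have hmem : b * y ^ (k + m) ∈ Ideal.span {y} ^ (k + m) • (⊤ : Submodule A A) ⊓
      (Ideal.span {x ^ m} : Submodule A A) := by
    refine ⟨?_, ?_⟩
    · rw [smul_eq_mul, Ideal.mul_top, Ideal.span_singleton_pow]
      exact Ideal.mem_span_singleton'.2 ⟨b, rfl⟩
    · refine Ideal.mem_span_singleton'.2 ⟨-(a * x ^ k), ?_⟩
      rw [eq_neg_of_add_eq_zero_right hab]
      ring
  rw [hk (k + m) (Nat.le_add_right _ _), Nat.add_sub_cancel_left] at hmem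
  replace hmem := Submodule.smul_mono le_rfl inf_le_right hmem
  rw [smul_eq_mul, Ideal.span_singleton_pow, Ideal.span_singleton_mul_span_singleton] at hmem
  obtain ⟨c, hc⟩ := Ideal.mem_span_singleton'.1 hmem
  refine ⟨-c, ?_, ?_⟩
  · apply mul_right_cancel₀ (pow_ne_zero m hx)
    linear_combination hab + hc
  · apply mul_right_cancel₀ (pow_ne_zero m hy)
    linear_combination -hc

variable {P₀ P₁ P₂ P₃ : Type*} [AddCommGroup P₀] [AddCommGroup P₁] [AddCommGroup P₂]
  [AddCommGroup P₃] [Module A P₀] [Module A P₁] [Module A P₂] [Module A P₃]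

/-- The data of a morphism from the Koszul complex on `a`, `b` to a complex augmented over
`A ⧸ J` which lifts the quotient map. -/
structure IsKoszulLift {J : Ideal A} (π : P₀ →ₗ[A] A ⧸ J) (d₁ : P₁ →ₗ[A] P₀) (d₂ : P₂ →ₗ[A] P₁)
    (a b : A) (p₀ : P₀) (p₁ q₁ : P₁) (p₂ : P₂) : Prop where
  augmentation : π p₀ = Ideal.Quotient.mk J 1
  left : d₁ p₁ = a • p₀
  right : d₁ q₁ = b • p₀
  top : d₂ p₂ = a • q₁ - b • p₁

theorem exists_isKoszulLift {J : Ideal A} {π : P₀ →ₗ[A] A ⧸ J} {d₁ : P₁ →ₗ[A] P₀}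
    {d₂ : P₂ →ₗ[A] P₁} (hπ : Function.Surjective π) (h₁ : Function.Exact d₁ π)
    (h₂ : Function.Exact d₂ d₁) {a b : A} (ha : a ∈ J) (hb : b ∈ J) :
    ∃ p₀ p₁ q₁ p₂, IsKoszulLift π d₁ d₂ a b p₀ p₁ q₁ p₂ := by
  obtain ⟨p₀, hp₀⟩ := hπ (Ideal.Quotient.mk J 1)
  have key : ∀ c ∈ J, ∃ p, d₁ p = c • p₀ := by
    intro c hc
    refine (h₁ _).1 ?_
    rw [map_smul, hp₀]
    change Ideal.Quotient.mk J (c • 1) = 0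
    rw [Ideal.Quotient.eq_zero_iff_mem]
    simpa using hc
  obtain ⟨p₁, hp₁⟩ := key a ha
  obtain ⟨q₁, hq₁⟩ := key b hb
  obtain ⟨p₂, hp₂⟩ := (h₂ (a • q₁ - b • p₁)).1 (by
    rw [map_sub, map_smul, map_smul, hp₁, hq₁, smul_smul, smul_smul, mul_comm, sub_self])
  exact ⟨p₀, p₁, q₁, p₂, hp₀, hp₁, hq₁, hp₂⟩

/-- The maps α₀, α go from the resolution to the Koszul complex on x^(k+m), y^(k+m). That complex
need not be exact, but by `hkm` degree-one cycles become boundaries after passing to the complex on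
x^m, y^m; `g` is the resulting degree-two component. The last clause says that the composite from
the Koszul complex on x^N, y^N is, up to homotopy, the standard transition map, which is
multiplication by (xy)^(N-m) in degree two; the sign comes from the convention in
`IsKoszulLift.top`. -/
theorem exists_cocycle [IsDomain A] {J : Ideal A} {π : P₀ →ₗ[A] A ⧸ J} {d₁ : P₁ →ₗ[A] P₀}
    {d₂ : P₂ →ₗ[A] P₁} {d₃ : P₃ →ₗ[A] P₂} [Module.Projective A P₀] [Module.Projective A P₁]
    (h₁ : ∀ p, π (d₁ p) = 0) (h₂ : ∀ p, d₁ (d₂ p) = 0) (h₃ : ∀ p, d₂ (d₃ p) = 0)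
    {x y : A} (hy : y ≠ 0) {k m : ℕ} (hJ : J ≤ Ideal.span {x ^ (k + m), y ^ (k + m)})
    (hkm : ∀ a b : A, a * x ^ (k + m) + b * y ^ (k + m) = 0 →
      ∃ c, a * x ^ k = c * y ^ m ∧ b * y ^ k = -(c * x ^ m)) :
    ∃ g : P₂ →ₗ[A] A, (∀ p, g (d₃ p) = 0) ∧
      (∀ w ∈ Ideal.span {x ^ m, y ^ m}, ∃ h : P₁ →ₗ[A] A, ∀ p, w * g p = h (d₂ p)) ∧
      ∀ N, k + m ≤ N → ∀ p₀ p₁ q₁ p₂, IsKoszulLift π d₁ d₂ (x ^ N) (y ^ N) p₀ p₁ q₁ p₂ →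
        g p₂ + (x * y) ^ (N - m) ∈ Ideal.span {x ^ N, y ^ N} := by
  set I : Ideal A := Ideal.span {x ^ (k + m), y ^ (k + m)} with hI
  obtain ⟨α₀, hα₀⟩ := Module.projective_lifting_property (Submodule.mkQ I)
    ((Submodule.mapQ J I LinearMap.id hJ).comp π) (Submodule.mkQ_surjective I)
  replace hα₀ : ∀ p, Submodule.mkQ I (α₀ p) = Submodule.mapQ J I LinearMap.id hJ (π p) :=
    fun p => LinearMap.congr_fun hα₀ p
  have hmem : ∀ p, α₀ (d₁ p) ∈ I := by
    intro p
    rw [← Submodule.Quotient.mk_eq_zero I]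
    change Submodule.mkQ I _ = 0
    rw [hα₀, h₁, map_zero]
  let σ : A × A →ₗ[A] A :=
    (LinearMap.mulRight A (x ^ (k + m))).coprod (LinearMap.mulRight A (y ^ (k + m)))
  have hσ : ∀ q, σ q ∈ I := fun q =>
    Ideal.mem_span_pair.2 ⟨q.1, q.2, by simp [σ]⟩
  obtain ⟨α, hα⟩ := Module.projective_lifting_property (σ.codRestrict I hσ)
    ((α₀.comp d₁).codRestrict I hmem) (by
      rintro ⟨r, hr⟩
      obtain ⟨a, b, hab⟩ := Ideal.mem_span_pair.1 hr
      exact ⟨(a, b), Subtype.ext (by simpa [σ] using hab)⟩)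
  replace hα : ∀ p, (α p).1 * x ^ (k + m) + (α p).2 * y ^ (k + m) = α₀ (d₁ p) := by
    intro p
    have := congrArg Subtype.val (LinearMap.congr_fun hα p)
    simpa [σ] using this
  have hex : ∀ p : P₂, ∃ c, (α (d₂ p)).1 * x ^ k = c * y ^ m ∧
      (α (d₂ p)).2 * y ^ k = -(c * x ^ m) := fun p =>
    hkm _ _ (by rw [hα, h₂, map_zero])
  choose γ hγ₁ hγ₂ using hex
  have hym : y ^ m ≠ 0 := pow_ne_zero m hy
  -- The chosen γ is linear because its values are determined after multiplication by the
  -- nonzerodivisor y^m.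
  let g : P₂ →ₗ[A] A :=
    { toFun := γ
      map_add' := fun p q => by
        apply mul_right_cancel₀ hym
        rw [← hγ₁, map_add, map_add, Prod.fst_add, add_mul, add_mul, hγ₁, hγ₁]
      map_smul' := fun r p => by
        apply mul_right_cancel₀ hym
        rw [← hγ₁, map_smul, map_smul, Prod.smul_fst, smul_eq_mul, mul_assoc, hγ₁]
        simp [mul_assoc] }
  refine ⟨g, fun p => ?_, ?_, ?_⟩
  · apply mul_right_cancel₀ hym
    change γ _ * _ = _
    rw [← hγ₁, h₃, map_zero]
    simp
  · intro w hw
    obtain ⟨a, b, rfl⟩ := Ideal.mem_span_pair.1 hw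
    refine ⟨(b * x ^ k) • (LinearMap.fst A A A).comp α -
      (a * y ^ k) • (LinearMap.snd A A A).comp α, fun p => ?_⟩
    change _ * γ p = b * x ^ k * (α (d₂ p)).1 - a * y ^ k * (α (d₂ p)).2
    linear_combination (-b) * hγ₁ p + a * hγ₂ p
  · intro N hN p₀ p₁ q₁ p₂ h
    have h1 : α₀ p₀ - 1 ∈ I := by
      rw [← Submodule.Quotient.mk_eq_zero I, Submodule.Quotient.mk_sub, sub_eq_zero]
      change Submodule.mkQ I _ = _
      rw [hα₀, h.augmentation]
      rfl
    obtain ⟨e, e', he⟩ := Ideal.mem_span_pair.1 h1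
    obtain ⟨N, rfl⟩ := Nat.exists_eq_add_of_le hN
    have ep := hα p₁
    have eq := hα q₁
    rw [h.left, map_smul, smul_eq_mul] at ep
    rw [h.right, map_smul, smul_eq_mul] at eq
    -- The values of α on p₁ and q₁ differ from the standard (x^N, 0) and (0, y^N), with N now the
    -- excess over k + m, by a homotopy term in (e, e') plus a cycle; each cycle becomes a boundary,
    -- with coefficient c or c'.
    obtain ⟨c, hc, hc'⟩ := hkm ((α p₁).1 - x ^ N - x ^ (k + m + N) * e)
      ((α p₁).2 - x ^ (k + m + N) * e') (by
        linear_combination (exp := 1) ep - x ^ (k + m + N) * he)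
    obtain ⟨c', hd, hd'⟩ := hkm ((α q₁).1 - y ^ (k + m + N) * e)
      ((α q₁).2 - y ^ N - y ^ (k + m + N) * e') (by
        linear_combination (exp := 1) eq - y ^ (k + m + N) * he)
    refine Ideal.mem_span_pair.2 ⟨c', -c, ?_⟩
    apply mul_right_cancel₀ hym
    have key := hγ₁ p₂
    rw [h.top, map_sub, map_smul, map_smul, Prod.fst_sub, Prod.smul_fst, Prod.smul_fst,
      smul_eq_mul, smul_eq_mul] at key
    have hsub : k + m + N - m = k + N := by omega
    rw [hsub]
    change _ = (γ p₂ + _) * _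
    rw [mul_pow]
    linear_combination key - x ^ (k + m + N) * hd + y ^ (k + m + N) * hc

end Koszul

/-- The class is that of z·g. Since rz lies in (x^m, y^m), rz·g is a coboundary. If s^k killed the
class, s^k z·g would become a coboundary over some A/J^N; its value on a Koszul two-cell lies in
(x^N, y^N), yet is congruent to -s^k z(xy)^(N-m). -/
theorem exists_localCohomology_two_torsion {A : Type w} [CommRing A] [IsDomain A]
    [IsNoetherianRing A] {x y : A} (hx : x ≠ 0) (hy : y ≠ 0) {r s z : A} {m : ℕ}
    (hr : r * z ∈ Ideal.span {x ^ m, y ^ m})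
    (hs : ∀ N k, m ≤ N → s ^ k * (z * (x * y) ^ (N - m)) ∉ Ideal.span {x ^ N, y ^ N}) :
    ∃ ζ : ((localCohomology (Ideal.span {x, y}) 2).obj (ModuleCat.of A A) : ModuleCat.{w} A),
      r • ζ = 0 ∧ ∀ k : ℕ, s ^ k • ζ ≠ 0 := by
  obtain ⟨k₀, hk₀⟩ := exists_koszul_cycle_eq_boundary hx hy m
  set J : Ideal A := Ideal.span {x, y} with hJ
  set t := (k₀ + m) + (k₀ + m) with ht
  have hJt : J ^ t ≤ Ideal.span {x ^ (k₀ + m), y ^ (k₀ + m)} := span_pair_pow_le x y _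
  let Q : ∀ n : ℕ, ProjectiveResolution (ModuleCat.of A (A ⧸ J ^ n)) :=
    fun n => projectiveResolution _
  let π : ∀ n : ℕ, (Q n).complex.X 0 →ₗ[A] A ⧸ J ^ n := fun n => ((Q n).π.f 0).hom
  have hproj : ∀ n i, Module.Projective A ((Q n).complex.X i) := fun n i =>
    (IsProjective.iff_projective _ ).2 ((Q n).projective i)
  have hdd : ∀ n i p, ((Q n).complex.d (i + 1) i).hom (((Q n).complex.d (i + 2) (i + 1)).hom p)
      = 0 := fun n i p => by
    have := (Q n).complex.d_comp_d (i + 2) (i + 1) i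
    exact congrArg (fun f => f.hom p) this
  have hπd : ∀ n p, π n (((Q n).complex.d 1 0).hom p) = 0 := fun n p =>
    congrArg (fun f => f.hom p) (Q n).complex_d_comp_π_f_zero
  obtain ⟨g, hg, hgb, hgN⟩ := exists_cocycle (π := π t) (hπd t) (hdd t 0) (hdd t 1) hy hJt hk₀
  obtain ⟨ι, hι⟩ := exists_localCohomology_map J 2 (ModuleCat.of A A) t
  let G : A → ((Q t).complex.X 2 ⟶ ModuleCat.of A A) := fun a => ModuleCat.ofHom (a • g)
  have hG : ∀ a, (Q t).complex.d 3 2 ≫ G a = 0 := fun a => by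
    ext p
    exact (congrArg (a * ·) (hg p)).trans (mul_zero a)
  have hGs : ∀ a b, b • extClass (Q t) _ 2 (G a) (hG a) = extClass (Q t) _ 2 (G (b * a)) (hG _) := by
    intro a b
    have hGb : G (b * a) = b • G a := by
      ext p
      exact mul_assoc b a _
    rw [← extClass_smul _ _ _ _ _ _ (by rw [← hGb, hG])]
    congr 1
    exact hGb.symm
  refine ⟨ι (extClass (Q t) _ 2 (G z) (hG z)), ?_, fun k hk => ?_⟩
  · rw [← map_smul, hGs, (extClass_eq_zero_iff _ _ _ _ _).2, map_zero]
    obtain ⟨h, hh⟩ := hgb _ hr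
    exact ⟨ModuleCat.ofHom h, by ext p; exact hh p⟩
  · rw [← map_smul, hGs] at hk
    obtain ⟨N, htN, hN⟩ := hι _ hk
    set f : ModuleCat.of A (A ⧸ J ^ N) ⟶ ModuleCat.of A (A ⧸ J ^ t) :=
      ModuleCat.ofHom (Submodule.mapQ (J ^ N) (J ^ t) LinearMap.id (Ideal.pow_le_pow_right htN))
      with hf
    let φ := ProjectiveResolution.lift f (Q N) (Q t)
    have comm : φ.f 0 ≫ (Q t).π.f 0 = (Q N).π.f 0 ≫ f :=
      ProjectiveResolution.lift_commutes_zero f (Q N) (Q t)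
    have hcoc : (Q N).complex.d 3 2 ≫ φ.f 2 ≫ G (s ^ k * z) = 0 := by
      rw [← φ.comm_assoc, hG, comp_zero]
    rw [extClass_map (Q t) (Q N) f φ comm _ 2 _ (hG _) hcoc, extClass_eq_zero_iff] at hN
    obtain ⟨h, hh⟩ := hN
    obtain ⟨p₀, p₁, q₁, p₂, hp⟩ := exists_isKoszulLift (π := π N)
      (d₁ := ((Q N).complex.d 1 0).hom) (d₂ := ((Q N).complex.d 2 1).hom)
      ((ModuleCat.epi_iff_surjective _).1 inferInstance)
      ((ShortComplex.ShortExact.moduleCat_exact_iff_function_exact _).1 (Q N).exact₀)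
      ((ShortComplex.ShortExact.moduleCat_exact_iff_function_exact _).1 ((Q N).exact_succ 0))
      (a := x ^ N) (b := y ^ N)
      (Ideal.pow_mem_pow (Ideal.subset_span (by simp)) N)
      (Ideal.pow_mem_pow (Ideal.subset_span (by simp)) N)
    have hφ : ∀ i p, ((Q t).complex.d (i + 1) i).hom ((φ.f (i + 1)).hom p) =
        (φ.f i).hom (((Q N).complex.d (i + 1) i).hom p) := fun i p =>
      congrArg (fun f => f.hom p) (φ.comm (i + 1) i)
    have hpt : IsKoszulLift (π t) ((Q t).complex.d 1 0).hom ((Q t).complex.d 2 1).hom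
        (x ^ N) (y ^ N) ((φ.f 0).hom p₀) ((φ.f 1).hom p₁) ((φ.f 1).hom q₁) ((φ.f 2).hom p₂) := by
      refine ⟨?_, ?_, ?_, ?_⟩
      · refine (congrArg (fun f => f.hom p₀) comm).trans ?_
        change f.hom (π N p₀) = _
        rw [hp.augmentation]
        rfl
      · rw [hφ, hp.left, map_smul]
      · rw [hφ, hp.right, map_smul]
      · rw [hφ, hp.top, map_sub, map_smul, map_smul]
    have h1 := hgN N (by omega) _ _ _ _ hpt
    have h2 : s ^ k * z * g ((φ.f 2).hom p₂) = h.hom (((Q N).complex.d 2 1).hom p₂) :=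
      congrArg (fun f => f.hom p₂) hh
    rw [hp.top, map_sub, map_smul, map_smul] at h2
    have h3 : s ^ k * z * g ((φ.f 2).hom p₂) ∈ Ideal.span {x ^ N, y ^ N} := by
      rw [h2]
      exact sub_mem (Ideal.mul_mem_right _ _ (Ideal.subset_span (by simp)))
        (Ideal.mul_mem_right _ _ (Ideal.subset_span (by simp)))
    apply hs N k (by omega)
    convert sub_mem (Ideal.mul_mem_left _ (s ^ k * z) h1) h3 using 1
    ring

end LocalCohomology

/-! ### Strong divisibility of the recurrent sequence. -/

section Recurrence

variable {A : Type*} [CommRing A]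

/-- The linear recurrence `d₀ = 0`, `d₁ = 1`, `d_{j+2} = -t d_{j+1} - s² d_j`; up to sign, `d_{n+1}`
is the determinant of the tridiagonal `n × n` matrix with `t` on the diagonal and `s` next to it. -/
def recSeq (s t : A) : ℕ → A
  | 0 => 0
  | 1 => 1
  | n + 2 => -t * recSeq s t (n + 1) - s ^ 2 * recSeq s t n

theorem recSeq_add (s t : A) (a b : ℕ) :
    recSeq s t (a + b + 1) =
      recSeq s t (a + 1) * recSeq s t (b + 1) - s ^ 2 * recSeq s t a * recSeq s t b := by
  induction b using Nat.twoStepInduction with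
  | zero => simp [recSeq]
  | one => simp [recSeq]; ring
  | more b h₁ h₂ =>
    have e : recSeq s t (a + (b + 2) + 1) =
        -t * recSeq s t (a + (b + 1) + 1) - s ^ 2 * recSeq s t (a + b + 1) := rfl
    rw [e, h₁, h₂]
    have e₁ : recSeq s t (b + 2 + 1) =
        -t * recSeq s t (b + 1 + 1) - s ^ 2 * recSeq s t (b + 1) := rfl
    have e₂ : recSeq s t (b + 2) = -t * recSeq s t (b + 1) - s ^ 2 * recSeq s t b := rfl
    rw [e₁, e₂]
    ring

theorem map_recSeq {B : Type*} [CommRing B] (f : A →+* B) (s t : A) (n : ℕ) :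
    f (recSeq s t n) = recSeq (f s) (f t) n := by
  induction n using Nat.twoStepInduction with
  | zero => simp [recSeq]
  | one => simp [recSeq]
  | more n h₁ h₂ => simp [recSeq, h₁, h₂]

variable [IsDomain A] {s t : A}

/-- Two consecutive zeros would propagate down, after cancelling s², to d_1 = 1. -/
theorem recSeq_succ_ne_zero (hs : s ≠ 0) {a : ℕ} (ha : recSeq s t a = 0) :
    recSeq s t (a + 1) ≠ 0 := by
  induction a with
  | zero => simp [recSeq]
  | succ a ih =>
    intro h
    have e : recSeq s t (a + 1 + 1) = -t * recSeq s t (a + 1) - s ^ 2 * recSeq s t a := rfl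
    rw [e, ha] at h
    have : recSeq s t a = 0 := by simpa [hs] using h
    exact ih this ha

/-- When d_a = 0 the addition formula reduces to d_(a+b) = d_(a+1)·d_b, with d_(a+1) ≠ 0. This is
the subtraction step of the Euclidean algorithm. -/
theorem recSeq_eq_zero_of_add (hs : s ≠ 0) {a b : ℕ} (ha : recSeq s t a = 0)
    (hab : recSeq s t (b + a) = 0) : recSeq s t b = 0 := by
  cases b with
  | zero => rfl
  | succ b =>
    have := recSeq_add s t a b
    rw [show a + b + 1 = b + 1 + a by ring, hab, ha] at this
    simpa [recSeq_succ_ne_zero hs ha] using this.symm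

theorem recSeq_eq_zero_of_add_mul (hs : s ≠ 0) {a b : ℕ} (k : ℕ) (ha : recSeq s t a = 0)
    (hab : recSeq s t (b + a * k) = 0) : recSeq s t b = 0 := by
  induction k with
  | zero => simpa using hab
  | succ k ih => exact ih (recSeq_eq_zero_of_add hs ha (by rwa [add_assoc, ← Nat.mul_succ]))

theorem recSeq_gcd_eq_zero (hs : s ≠ 0) {a b : ℕ} (ha : recSeq s t a = 0)
    (hb : recSeq s t b = 0) : recSeq s t (a.gcd b) = 0 := by
  induction a, b using Nat.gcd.induction with
  | H0 n => simpa using hb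
  | H1 m n hm ih =>
    rw [Nat.gcd_rec]
    exact ih (recSeq_eq_zero_of_add_mul hs (n / m) ha (by rwa [Nat.mod_add_div])) ha

theorem not_coprime_of_recSeq_eq_zero (hs : s ≠ 0) {a b : ℕ} (ha : recSeq s t a = 0)
    (hb : recSeq s t b = 0) : ¬ a.Coprime b := by
  intro h
  have := recSeq_gcd_eq_zero hs ha hb
  rw [h] at this
  exact one_ne_zero this

end Recurrence

/-! ### Associated primes separated by the recurrence. -/

section AssociatedPrimes

variable {A : Type*} [CommRing A]

/-- Take a maximal annihilator among elements killed by r and by no power of s. It is prime: if a·m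
stays in this family, maximality gives ann(a·m) = ann(m); otherwise a kills some s^k·m, which is in
the family, so a kills m. -/
theorem exists_associatedPrime [IsNoetherianRing A] {M : Type*} [AddCommGroup M] [Module A M] {r s : A} {z : M}
    (hr : r • z = 0) (hs : ∀ k : ℕ, s ^ k • z ≠ 0) :
    ∃ Q ∈ associatedPrimes A M, r ∈ Q ∧ s ∉ Q := by
  let ann : M → Ideal A := fun m => LinearMap.ker (LinearMap.toSpanSingleton A M m)
  have hann : ∀ m a, a ∈ ann m ↔ a • m = 0 := fun m a => by simp [ann]
  obtain ⟨Q, ⟨m, ⟨hrm, hsm⟩, rfl⟩, hmax⟩ := set_has_maximal_iff_noetherian.2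
    (inferInstance : IsNoetherian A A) (ann '' {m | r • m = 0 ∧ ∀ k : ℕ, s ^ k • m ≠ 0})
    ⟨_, z, ⟨hr, hs⟩, rfl⟩
  have key : ∀ a : A, (∀ k : ℕ, s ^ k • a • m ≠ 0) → ann (a • m) ≤ ann m := by
    intro a ha
    have hle : ann m ≤ ann (a • m) := fun b hb => by
      rw [hann] at hb ⊢
      rw [smul_comm, hb, smul_zero]
    have := hmax _ ⟨a • m, ⟨by rw [smul_comm, hrm, smul_zero], ha⟩, rfl⟩
    exact (not_lt_iff_le_imp_ge.1 this) hle
  refine ⟨ann m, ?_, (hann _ _).2 hrm, fun h => hsm 1 (by rw [pow_one]; exact (hann _ _).1 h)⟩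
  rw [AssociatedPrimes.mem_iff, IsAssociatedPrime, Submodule.isAssociatedPrime_iff]
  refine ⟨⟨?_, ?_⟩, m, ?_⟩
  · rw [Ideal.ne_top_iff_one, hann, one_smul]
    simpa using hsm 0
  · intro a b hab
    rw [or_iff_not_imp_left]
    intro ha
    by_cases h : ∀ k : ℕ, s ^ k • a • m ≠ 0
    · refine key a h ((hann _ _).2 ?_)
      rw [smul_smul, mul_comm]
      exact (hann _ _).1 hab
    · push Not at h
      obtain ⟨k, hk⟩ := h
      refine absurd (key (s ^ k) (fun j => ?_) ((hann _ a).2 ?_)) ha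
      · rw [smul_smul, ← pow_add]
        exact hsm _
      · rw [smul_comm]
        exact hk
  · ext a
    rw [hann, Submodule.mem_colon_singleton, Submodule.mem_bot]

theorem infinite_of_forall_prime {s t : A} {S : Set (Ideal A)} (hS : ∀ Q ∈ S, Q.IsPrime)
    (h : ∀ l : ℕ, l.Prime → ∃ Q ∈ S, recSeq s t l ∈ Q ∧ s ∉ Q) : S.Infinite := by
  choose! Q hQS hQ hsQ using h
  refine Set.infinite_of_injective_forall_mem (f := fun l : Nat.Primes => Q l) ?_
    fun l => hQS l l.2
  intro l l' hll
  by_contra hne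
  have hl := hQ l l.2
  have hl' := hQ l' l'.2
  have hs := hsQ l l.2
  replace hll : Q l = Q l' := hll
  rw [← hll] at hl'
  have := hS _ (hQS l l.2)
  rw [← Ideal.Quotient.eq_zero_iff_mem, map_recSeq] at hl hl'
  rw [← Ideal.Quotient.eq_zero_iff_mem] at hs
  exact not_coprime_of_recSeq_eq_zero hs hl hl'
    ((Nat.coprime_primes l.2 l'.2).2 fun e => hne (Subtype.ext e))

end AssociatedPrimes

/-- With X = ux and Y = vy, induction gives s^k X^(k+1) Y^(n-k-1) ≡ d_(k+1) XYⁿ⁻¹ modulo Yⁿ. At k =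
n - 1, after multiplication by (xy)^(m-n), the term in Xⁿ is divisible by x^m and the error in Yⁿ by
y^m. -/
theorem recSeq_mul_mem {A : Type*} [CommRing A] {s t u v x y : A}
    (h : s * u ^ 2 * x ^ 2 + t * u * x * v * y + s * v ^ 2 * y ^ 2 = 0) {n m : ℕ} (hn : 1 ≤ n)
    (hm : n ≤ m) :
    recSeq s t n * (u * x * (v * y) ^ (n - 1) * (x * y) ^ (m - n)) ∈
      Ideal.span {x ^ m, y ^ m} := by
  set c := (x * y) ^ (m - n) with hc
  have key : ∀ k, k + 1 ≤ n → ∃ a, s ^ k * ((u * x) ^ (k + 1) * (v * y) ^ (n - (k + 1)) * c) =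
      recSeq s t (k + 1) * (u * x * (v * y) ^ (n - 1) * c) + a * ((v * y) ^ n * c) := by
    intro k
    induction k using Nat.twoStepInduction with
    | zero => exact fun _ => ⟨0, by simp [recSeq]⟩
    | one =>
      intro h2
      obtain ⟨n, rfl⟩ := Nat.exists_eq_add_of_le' h2
      refine ⟨-s, ?_⟩
      simp only [recSeq, Nat.add_sub_cancel, show n + (1 + 1) - 1 = n + 1 by omega]
      linear_combination (v * y) ^ n * c * h
    | more k ih₁ ih₂ =>
      intro h3
      obtain ⟨a₁, h₁⟩ := ih₁ (by omega)
      obtain ⟨a₂, h₂⟩ := ih₂ (by omega)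
      obtain ⟨n, rfl⟩ := Nat.exists_eq_add_of_le' h3
      refine ⟨-t * a₂ - s ^ 2 * a₁, ?_⟩
      have e : recSeq s t (k + 2 + 1) =
        -t * recSeq s t (k + 1 + 1) - s ^ 2 * recSeq s t (k + 1) := rfl
      rw [e]
      rw [show n + (k + 2 + 1) - (k + 1) = n + 2 by omega] at h₁
      rw [show n + (k + 2 + 1) - (k + 1 + 1) = n + 1 by omega] at h₂
      rw [Nat.add_sub_cancel]
      linear_combination (-t) * h₂ - s ^ 2 * h₁ +
        s ^ (k + 1) * (u * x) ^ (k + 1) * (v * y) ^ n * c * h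
  obtain ⟨n, rfl⟩ := Nat.exists_eq_add_of_le' hn
  obtain ⟨m, rfl⟩ := Nat.exists_eq_add_of_le' hm
  obtain ⟨a, ha⟩ := key n le_rfl
  rw [Nat.add_sub_cancel] at hc
  refine Ideal.mem_span_pair.2 ⟨s ^ n * u ^ (n + 1) * y ^ m, -a * v ^ (n + 1) * x ^ m, ?_⟩
  rw [Nat.sub_self, pow_zero] at ha
  rw [← sub_eq_iff_eq_add] at ha
  rw [← ha, hc]
  ring

/-! ### A linear form that vanishes on the ideal but not on the witness. -/

section Functional

open MvPolynomial

variable {L : Type*} [CommRing L]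

/-- The value of `linForm` on the monomial `u^a v^b x^p y^q`. -/
def linWeight (c : ℕ → L) (n j a b p q : ℕ) : L :=
  if p = a + j ∧ q = b + j ∧ a + b = n then c a else 0

/-- The linear form on `L[u, v, x, y]` which sends the monomial
`(u x)^i (v y)^(n-i) (x y)^j` to `c i`, and all other monomials to `0`. -/
noncomputable def linForm (c : ℕ → L) (n j : ℕ) : MvPolynomial (Fin 4) L →ₗ[L] L :=
  (basisMonomials (Fin 4) L).constr L fun e => linWeight c n j (e 0) (e 1) (e 2) (e 3)

theorem linForm_monomial (c : ℕ → L) (n j : ℕ) (e : Fin 4 →₀ ℕ) (r : L) :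
    linForm c n j (monomial e r) = r * linWeight c n j (e 0) (e 1) (e 2) (e 3) := by
  have h : monomial e r = r • basisMonomials (Fin 4) L e := by
    simp [smul_monomial]
  rw [h, map_smul, linForm, Module.Basis.constr_basis, smul_eq_mul]

theorem linForm_mul_monomial (c : ℕ → L) (n j a b p q : ℕ) (e : Fin 4 →₀ ℕ) (r : L) :
    linForm c n j (X 0 ^ a * X 1 ^ b * X 2 ^ p * X 3 ^ q * monomial e r) =
      r * linWeight c n j (e 0 + a) (e 1 + b) (e 2 + p) (e 3 + q) := by
  have h : X 0 ^ a * X 1 ^ b * X 2 ^ p * X 3 ^ q * monomial e r =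
      monomial (e + Finsupp.single 0 a + Finsupp.single 1 b + Finsupp.single 2 p +
        Finsupp.single 3 q) r := by
    simp only [monomial_add_single]
    ring
  rw [h, linForm_monomial]
  simp

theorem linForm_mul_eq_zero {c : ℕ → L} {n j : ℕ} {p : MvPolynomial (Fin 4) L}
    (h : ∀ e r, linForm c n j (p * monomial e r) = 0) (q : MvPolynomial (Fin 4) L) :
    linForm c n j (p * q) = 0 := by
  induction q using MvPolynomial.induction_on' with
  | monomial e r => exact h e r
  | add p q hp hq => rw [mul_add, map_add, hp, hq, add_zero]

/-- A weighted monomial divisible by x^(n+j) must have u-exponent n, where the weight is c_n = 0;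
for y the u-exponent is 0. -/
theorem linForm_x_pow_mul {c : ℕ → L} {n j : ℕ} (hn : c n = 0) (q : MvPolynomial (Fin 4) L) :
    linForm c n j (X 2 ^ (n + j) * q) = 0 := by
  refine linForm_mul_eq_zero (fun e r => ?_) q
  have := linForm_mul_monomial c n j 0 0 (n + j) 0 e r
  simp only [pow_zero, one_mul, mul_one] at this
  rw [this, linWeight]
  split_ifs with h
  · rw [show e 0 + 0 = n by omega, hn, mul_zero]
  · rw [mul_zero]

theorem linForm_y_pow_mul {c : ℕ → L} {n j : ℕ} (h0 : c 0 = 0) (q : MvPolynomial (Fin 4) L) :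
    linForm c n j (X 3 ^ (n + j) * q) = 0 := by
  refine linForm_mul_eq_zero (fun e r => ?_) q
  have := linForm_mul_monomial c n j 0 0 0 (n + j) e r
  simp only [pow_zero, one_mul] at this
  rw [this, linWeight]
  split_ifs with h
  · rw [show e 0 + 0 = 0 by omega, h0, mul_zero]
  · rw [mul_zero]

theorem linForm_quadric_mul {c : ℕ → L} {n j : ℕ} {μ : L} (hc : ∀ i, c (i + 2) = μ * c (i + 1) - c i)
    (q : MvPolynomial (Fin 4) L) :
    linForm c n j ((X 0 ^ 2 * X 2 ^ 2 - C μ * (X 0 * X 2 * X 1 * X 3) + X 1 ^ 2 * X 3 ^ 2) * q) =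
      0 := by
  refine linForm_mul_eq_zero (fun e r => ?_) q
  have h₁ := linForm_mul_monomial c n j 2 0 2 0 e r
  have h₂ := linForm_mul_monomial c n j 1 1 1 1 e (μ * r)
  have h₃ := linForm_mul_monomial c n j 0 2 0 2 e r
  have e₁ : (X 0 ^ 2 * X 2 ^ 2 - C μ * (X 0 * X 2 * X 1 * X 3) + X 1 ^ 2 * X 3 ^ 2) *
      monomial e r = X 0 ^ 2 * X 1 ^ 0 * X 2 ^ 2 * X 3 ^ 0 * monomial e r -
        X 0 ^ 1 * X 1 ^ 1 * X 2 ^ 1 * X 3 ^ 1 * monomial e (μ * r) +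
        X 0 ^ 0 * X 1 ^ 2 * X 2 ^ 0 * X 3 ^ 2 * monomial e r := by
    rw [← C_mul_monomial]
    ring
  rw [e₁, map_add, map_sub, h₁, h₂, h₃]
  simp only [linWeight]
  by_cases h : e 2 = e 0 + j ∧ e 3 = e 1 + j ∧ e 0 + e 1 + 2 = n
  · rw [if_pos (by omega), if_pos (by omega), if_pos (by omega), hc]
    simp only [add_zero]
    ring
  · rw [if_neg (by omega), if_neg (by omega), if_neg (by omega)]
    ring

theorem linForm_mul_eq_constantCoeff {c : ℕ → L} {n j : ℕ} (h1 : c 1 = 1) (hn : 1 ≤ n)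
    (q : MvPolynomial (Fin 4) L) :
    linForm c n j (X 0 * X 2 * (X 1 * X 3) ^ (n - 1) * (X 2 * X 3) ^ j * q) =
      constantCoeff q := by
  induction q using MvPolynomial.induction_on' with
  | monomial e r =>
    have := linForm_mul_monomial c n j 1 (n - 1) (1 + j) (n - 1 + j) e r
    have e₁ : (X 0 * X 2 * (X 1 * X 3) ^ (n - 1) * (X 2 * X 3) ^ j : MvPolynomial (Fin 4) L) =
        X 0 ^ 1 * X 1 ^ (n - 1) * X 2 ^ (1 + j) * X 3 ^ (n - 1 + j) := by
      ring
    rw [e₁, this, linWeight, constantCoeff_monomial]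
    by_cases h : e = 0
    · subst h
      rw [if_pos rfl, if_pos (by simp; omega)]
      simp [h1]
    · rw [if_neg h, if_neg, mul_zero]
      rintro ⟨h₁, h₂, h₃⟩
      apply h
      ext i
      fin_cases i
      all_goals simp
      all_goals omega
  | add p q hp hq => rw [mul_add, map_add, hp, hq, map_add]

end Functional

/-! ### Choice of μ and the nonmembership criterion. -/

section NonMembership

open MvPolynomial

variable {K : Type*} [Field K]

/-- The sequence with `c₀ = 0`, `c₁ = 1`, `c_{j+2} = T c_{j+1} - c_j` in `K[T]`. -/
noncomputable def chebSeq (K : Type*) [Field K] : ℕ → Polynomial K :=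
  recSeq 1 (-Polynomial.X)

theorem chebSeq_degree (n : ℕ) :
    (chebSeq K (n + 1)).natDegree = n ∧ (chebSeq K (n + 1)).Monic := by
  induction n using Nat.twoStepInduction with
  | zero => simp [chebSeq, recSeq]
  | one => simp [chebSeq, recSeq, Polynomial.monic_X]
  | more n h₁ h₂ =>
    have e : chebSeq K (n + 2 + 1) =
        Polynomial.X * chebSeq K (n + 1 + 1) - chebSeq K (n + 1) := by
      simp [chebSeq, recSeq]
    have hX : (Polynomial.X * chebSeq K (n + 1 + 1)).Monic := Polynomial.monic_X.mul h₂.2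
    have hd : (Polynomial.X * chebSeq K (n + 1 + 1)).natDegree = n + 2 := by
      rw [Polynomial.natDegree_X_mul h₂.2.ne_zero, h₂.1]
    have hlt : (chebSeq K (n + 1)).natDegree <
        (Polynomial.X * chebSeq K (n + 1 + 1)).natDegree := by
      rw [hd, h₁.1]
      omega
    rw [e]
    exact ⟨by rw [Polynomial.natDegree_sub_eq_left_of_natDegree_lt hlt, hd],
      hX.sub_of_left (Polynomial.degree_lt_degree hlt)⟩

theorem exists_recSeq_eq_zero (K : Type*) [Field K] {n : ℕ} (hn : 2 ≤ n) :
    ∃ μ : AlgebraicClosure K, recSeq 1 (-μ) n = 0 := by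
  obtain ⟨n, rfl⟩ := Nat.exists_eq_add_of_le' hn
  obtain ⟨hd, hm⟩ := chebSeq_degree (K := AlgebraicClosure K) (n + 1)
  obtain ⟨μ, hμ⟩ := IsAlgClosed.exists_root (chebSeq (AlgebraicClosure K) (n + 1 + 1))
    (by
      rw [Polynomial.degree_eq_natDegree hm.ne_zero, hd]
      exact_mod_cast Nat.succ_ne_zero n)
  refine ⟨μ, ?_⟩
  rw [Polynomial.IsRoot, ← Polynomial.coe_evalRingHom, chebSeq, map_recSeq] at hμ
  simpa using hμ

/-- The specialization `s ↦ σ`, `t ↦ -σ μ`. -/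
noncomputable def specialize {L : Type*} [CommRing L] [Algebra K L] (σ μ : L) :
    MvPolynomial (Fin 6) K →+* MvPolynomial (Fin 4) L :=
  eval₂Hom (C.comp (algebraMap K L)) ![C σ, C (-σ * μ), X 0, X 1, X 2, X 3]

/-- The linear form kills the specialized ideal, while on p times the witness it returns the
constant coefficient of the specialized p. -/
theorem constantCoeff_specialize_eq_zero {L : Type*} [CommRing L] [Algebra K L] {σ μ : L}
    {n m : ℕ} (hn : 1 ≤ n) (hm : n ≤ m) (hμ : recSeq 1 (-μ) n = 0)
    {p : MvPolynomial (Fin 6) K}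
    (hp : specialize σ μ (p * (X 2 * X 4 * (X 3 * X 5) ^ (n - 1) * (X 4 * X 5) ^ (m - n))) ∈
      Ideal.span {specialize σ μ (poly K), X 2 ^ m, X 3 ^ m}) :
    constantCoeff (specialize σ μ p) = 0 := by
  obtain ⟨j, rfl⟩ := Nat.exists_eq_add_of_le hm
  obtain ⟨a, b, c, h⟩ := Submodule.mem_span_triple.1 hp
  rw [Nat.add_sub_cancel_left] at h
  rw [← linForm_mul_eq_constantCoeff (c := recSeq 1 (-μ)) (n := n) (j := j) rfl hn]
  have hf : specialize σ μ (poly K) =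
      C σ * (X 0 ^ 2 * X 2 ^ 2 - C μ * (X 0 * X 2 * X 1 * X 3) + X 1 ^ 2 * X 3 ^ 2) := by
    simp [specialize, poly]
    ring
  have hz : specialize σ μ (p * (X 2 * X 4 * (X 3 * X 5) ^ (n - 1) * (X 4 * X 5) ^ j)) =
      X 0 * X 2 * (X 1 * X 3) ^ (n - 1) * (X 2 * X 3) ^ j * specialize σ μ p := by
    simp [specialize]
    ring
  rw [← hz, ← h, hf]
  simp only [smul_eq_mul, map_add]
  rw [mul_comm b, mul_comm c, linForm_x_pow_mul hμ, linForm_y_pow_mul rfl,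
    show ∀ q r : MvPolynomial (Fin 4) L, a * (q * r) = r * (a * q) by intros; ring,
    linForm_quadric_mul]
  · simp
  · intro i
    simp [recSeq]

end NonMembership

open MvPolynomial

/-! ### Integrality of the three rings. -/

section Domain

variable (K : Type w) [Field K]

/-- The quadric `poly K` with the variable `s` replaced by `a`. -/
noncomputable def quadric (a : MvPolynomial (Fin 6) K) : MvPolynomial (Fin 6) K :=
  a * X 2 ^ 2 * X 4 ^ 2 + X 1 * X 2 * X 4 * X 3 * X 5 + a * X 3 ^ 2 * X 5 ^ 2

/-- The quadric is linear in t, with leading coefficient uxvy prime to the constant term: at the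
point with one of u, v, x, y equal to 0 and all other coordinates 1, the constant term takes the
value 1. -/
theorem prime_quadric {a : MvPolynomial (Fin 6) K} (ha : a ∈ supported K ({1}ᶜ : Set (Fin 6)))
    (ha1 : ∀ i ≠ 0, eval (Function.update 1 i 0) a = 1) : Prime (quadric K a) := by
  have hX : ∀ i : Fin 6, i ≠ 1 → (X i : MvPolynomial (Fin 6) K) ∈
      supported K ({1}ᶜ : Set (Fin 6)) := fun i hi =>
    X_mem_supported.2 hi
  have hvars : ∀ p ∈ supported K ({1}ᶜ : Set (Fin 6)), 1 ∉ p.vars := fun p hp h =>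
    (mem_supported.1 hp h) rfl
  have e : quadric K a = X 2 * X 4 * X 3 * X 5 * X 1 +
      (a * X 2 ^ 2 * X 4 ^ 2 + a * X 3 ^ 2 * X 5 ^ 2) := by
    rw [quadric]
    ring
  rw [e]
  refine (irreducible_mul_X_add _ _ 1 ?_ (hvars _ ?_) (hvars _ ?_) ?_).prime
  · simp [X_ne_zero]
  · exact mul_mem (mul_mem (mul_mem (hX 2 (by decide)) (hX 4 (by decide))) (hX 3 (by decide)))
      (hX 5 (by decide))
  · exact add_mem
      (mul_mem (mul_mem ha (pow_mem (hX 2 (by decide)) 2)) (pow_mem (hX 4 (by decide)) 2))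
      (mul_mem (mul_mem ha (pow_mem (hX 3 (by decide)) 2)) (pow_mem (hX 5 (by decide)) 2))
  · have key : ∀ i : Fin 6, i ∈ ({2, 3, 4, 5} : Finset (Fin 6)) →
        IsRelPrime (X i : MvPolynomial (Fin 6) K)
          (a * X 2 ^ 2 * X 4 ^ 2 + a * X 3 ^ 2 * X 5 ^ 2) := by
      intro i hi
      rw [(X_prime (i := i)).irreducible.isRelPrime_iff_not_dvd]
      rintro ⟨q, hq⟩
      have h := congrArg (eval (Function.update 1 i 0)) hq
      have hi0 : i ≠ 0 := by rintro rfl; simp at hi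
      simp only [map_add, map_mul, map_pow, eval_X, ha1 i hi0] at h
      fin_cases hi <;> simp [Function.update] at h
    exact ((((key 2 (by simp)).mul_left (key 4 (by simp))).mul_left (key 3 (by simp))).mul_left
      (key 5 (by simp)))

theorem prime_poly : Prime (poly K) :=
  prime_quadric K (a := X 0) (X_mem_supported.2 (by simp)) fun i hi => by
    simp [Function.update, hi.symm]

instance isDomain_R : IsDomain (R K) := by
  have := (Ideal.span_singleton_prime (prime_poly K).ne_zero).2 (prime_poly K)
  exact Ideal.Quotient.isDomain _

/-- The substitution `s ↦ 1`. -/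
noncomputable def substOne : MvPolynomial (Fin 6) K →+* MvPolynomial (Fin 6) K :=
  eval₂Hom C (Function.update X 0 1)

theorem substOne_poly : substOne K (poly K) = quadric K 1 := by
  simp [substOne, poly, quadric, Function.update]

/-- The homomorphism from `R` to the quotient by the quadric with `s = 1`. -/
noncomputable def toQuadricOne :
    R K →+* MvPolynomial (Fin 6) K ⧸ (Ideal.span {quadric K 1} : Ideal (MvPolynomial (Fin 6) K)) :=
  Ideal.Quotient.lift _ ((Ideal.Quotient.mk _).comp (substOne K)) (by
    intro a ha
    obtain ⟨b, rfl⟩ := Ideal.mem_span_singleton'.1 ha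
    rw [RingHom.comp_apply, map_mul, substOne_poly, Ideal.Quotient.eq_zero_iff_mem]
    exact Ideal.mul_mem_left _ _ (Ideal.mem_span_singleton_self _))

theorem toSpec1_mk_substOne (p : MvPolynomial (Fin 6) K) :
    toSpec1 K (Ideal.Quotient.mk _ (substOne K p)) = toSpec1 K (Ideal.Quotient.mk _ p) := by
  have : ((toSpec1 K).comp (Ideal.Quotient.mk _)).comp (substOne K) =
      (toSpec1 K).comp (Ideal.Quotient.mk _) := by
    apply ringHom_ext
    · intro r
      simp [substOne]
    · intro i
      by_cases hi : i = 0
      · subst hi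
        have h : toSpec1 K (s K - 1) = 0 :=
          Ideal.Quotient.eq_zero_iff_mem.2 (Ideal.mem_span_singleton_self _)
        rw [map_sub, map_one, sub_eq_zero] at h
        simpa [substOne] using h.symm
      · simp [substOne, Function.update, hi]
  exact RingHom.congr_fun this p

/-- Embedding R/(s-1) in a domain suffices for primality; the target keeps `X 0` as a free variable,
so no isomorphism is claimed. -/
theorem span_s_sub_one_eq_ker : Ideal.span {s K - 1} = RingHom.ker (toQuadricOne K) := by
  apply le_antisymm
  · rw [Ideal.span_singleton_le_iff_mem, RingHom.mem_ker]
    simp [toQuadricOne, substOne, s, var]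
  · intro r hr
    obtain ⟨p, rfl⟩ := Ideal.Quotient.mk_surjective r
    rw [RingHom.mem_ker, toQuadricOne, Ideal.Quotient.lift_mk, RingHom.comp_apply,
      Ideal.Quotient.eq_zero_iff_mem] at hr
    obtain ⟨q, hq⟩ := Ideal.mem_span_singleton'.1 hr
    rw [← Ideal.Quotient.eq_zero_iff_mem]
    change toSpec1 K _ = 0
    rw [← toSpec1_mk_substOne, ← hq, ← substOne_poly, map_mul, map_mul, toSpec1_mk_substOne,
      Ideal.Quotient.eq_zero_iff_mem.2 (Ideal.mem_span_singleton_self (poly K)), map_zero]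
    exact mul_zero (M₀ := Spec1 K) _

instance isDomain_Spec1 : IsDomain (Spec1 K) := by
  have hp : Prime (quadric K 1) := prime_quadric K (one_mem _) fun i hi => by simp
  have := (Ideal.span_singleton_prime hp.ne_zero).2 hp
  have : (Ideal.span {s K - 1}).IsPrime := by
    rw [span_s_sub_one_eq_ker]
    exact RingHom.ker_isPrime _
  exact Ideal.Quotient.isDomain _

instance isDomain_Loc : IsDomain (Loc K) :=
  IsLocalization.isDomain_localization (Ideal.primeCompl_le_nonZeroDivisors _)

end Domain

/-! ### Infinitely many associated primes from the nonmembership of witnesses. -/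

section Criterion

variable {A : Type w} [CommRing A]

/-- The element `(u x) (v y)^(n-1) (x y)^(m-n)`. -/
def witness (u v x y : A) (n m : ℕ) : A :=
  u * x * (v * y) ^ (n - 1) * (x * y) ^ (m - n)

theorem pow_mul_map_witness {B : Type*} [CommRing B] (f : A →+* B) (s u v x y : A) (k n m : ℕ) :
    f s ^ k * witness (f u) (f v) (f x) (f y) n m = f (s ^ k * witness u v x y n m) := by
  simp [witness]

theorem span_map_pow_pair {B : Type*} [CommRing B] (f : A →+* B) (x y : A) (m : ℕ) :
    Ideal.span {f x ^ m, f y ^ m} = (Ideal.span {x ^ m, y ^ m}).map f := by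
  rw [Ideal.map_span, Set.image_pair, map_pow, map_pow]

variable [IsNoetherianRing A] {s t u v x y : A}

theorem infinite_assPow (h : s * u ^ 2 * x ^ 2 + t * u * x * v * y + s * v ^ 2 * y ^ 2 = 0)
    (hs : ∀ n m k, 2 ≤ n → n ≤ m →
      s ^ k * witness u v x y n m ∉ Ideal.span {x ^ m, y ^ m}) {S : Set ℕ} (hS : S.Infinite) :
    (⋃ m ∈ S, assPow x y m).Infinite := by
  refine infinite_of_forall_prime (s := s) (t := t) ?_ fun l hl => ?_
  · intro Q hQ
    simp only [Set.mem_iUnion] at hQ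
    obtain ⟨m, _, hQ⟩ := hQ
    exact IsAssociatedPrime.isPrime hQ
  · obtain ⟨m, hm, hlm⟩ := hS.exists_gt l
    obtain ⟨Q, hQ, hrQ, hsQ⟩ := exists_associatedPrime (M := A ⧸ Ideal.span {x ^ m, y ^ m})
      (r := recSeq s t l) (s := s) (z := Ideal.Quotient.mk _ (witness u v x y l m))
      (by
        change Ideal.Quotient.mk _ (recSeq s t l * witness u v x y l m) = 0
        rw [Ideal.Quotient.eq_zero_iff_mem]
        exact recSeq_mul_mem h hl.one_le hlm.le)
      (fun k => by
        change Ideal.Quotient.mk _ (s ^ k * witness u v x y l m) ≠ 0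
        rw [Ne, Ideal.Quotient.eq_zero_iff_mem]
        exact hs l m k hl.two_le hlm.le)
    exact ⟨Q, Set.mem_biUnion hm hQ, hrQ, hsQ⟩

theorem infinite_assH2 [IsDomain A]
    (h : s * u ^ 2 * x ^ 2 + t * u * x * v * y + s * v ^ 2 * y ^ 2 = 0)
    (hs : ∀ n m k, 2 ≤ n → n ≤ m →
      s ^ k * witness u v x y n m ∉ Ideal.span {x ^ m, y ^ m}) :
    (assH2 x y).Infinite := by
  have hxy : x * y ≠ 0 := by
    intro h0
    -- With n < m the witness visibly contains the factor xy.
    apply hs 2 3 0 le_rfl (by norm_num)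
    simp [witness, h0]
  refine infinite_of_forall_prime (s := s) (t := t) ?_ fun l hl => ?_
  · exact fun Q hQ => IsAssociatedPrime.isPrime hQ
  · obtain ⟨ζ, hr, hk⟩ := exists_localCohomology_two_torsion (left_ne_zero_of_mul hxy)
      (right_ne_zero_of_mul hxy) (r := recSeq s t l) (s := s) (z := witness u v x y l l) (m := l)
      (recSeq_mul_mem h hl.one_le le_rfl) (fun N k hN => by
        have := hs l N k hl.two_le hN
        simpa [witness] using this)
    exact exists_associatedPrime hr hk

end Criterion

/-! ### Nonmembership in R, its localization and its specialization. -/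

section Witness

variable (K : Type w) [Field K]

theorem relation_R : s K * u K ^ 2 * x K ^ 2 + t K * u K * x K * v K * y K +
    s K * v K ^ 2 * y K ^ 2 = 0 := by
  have : (Ideal.Quotient.mk (Ideal.span {poly K}) (poly K) : R K) = 0 :=
    Ideal.Quotient.eq_zero_iff_mem.2 (Ideal.mem_span_singleton_self _)
  have map_poly : ∀ f : MvPolynomial (Fin 6) K →+* R K, f (poly K) =
      f (X 0) * f (X 2) ^ 2 * f (X 4) ^ 2 + f (X 1) * f (X 2) * f (X 4) * f (X 3) * f (X 5) +
        f (X 0) * f (X 3) ^ 2 * f (X 5) ^ 2 := fun f => by simp [poly]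
  exact (map_poly _).symm.trans this

theorem relation_map {B : Type*} [CommRing B] (f : R K →+* B) :
    f (s K) * f (u K) ^ 2 * f (x K) ^ 2 + f (t K) * f (u K) * f (x K) * f (v K) * f (y K) +
      f (s K) * f (v K) ^ 2 * f (y K) ^ 2 = 0 := by
  simpa only [map_add, map_mul, map_pow, map_zero] using congrArg f (relation_R K)

variable {K}

theorem exists_lift_relation {r : R K} {m : ℕ} (hr : r ∈ Ideal.span {x K ^ m, y K ^ m})
    {p : MvPolynomial (Fin 6) K} (hp : Ideal.Quotient.mk _ p = r) :
    p ∈ Ideal.span {poly K, X 4 ^ m, X 5 ^ m} := by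
  obtain ⟨a, b, h⟩ := Ideal.mem_span_pair.1 hr
  obtain ⟨a, rfl⟩ := Ideal.Quotient.mk_surjective a
  obtain ⟨b, rfl⟩ := Ideal.Quotient.mk_surjective b
  have h0 : Ideal.Quotient.mk (Ideal.span {poly K}) (p - (a * X 4 ^ m + b * X 5 ^ m)) = 0 := by
    rw [map_sub, hp, ← h]
    simp
  obtain ⟨c, hc⟩ := Ideal.mem_span_singleton'.1 (Ideal.Quotient.eq_zero_iff_mem.1 h0)
  exact Submodule.mem_span_triple.2 ⟨c, a, b, by simp only [smul_eq_mul]; linear_combination hc⟩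

theorem specialize_mem {L : Type*} [CommRing L] [Algebra K L] {σ μ : L} {m : ℕ}
    {p : MvPolynomial (Fin 6) K} (hp : p ∈ Ideal.span {poly K, X 4 ^ m, X 5 ^ m}) :
    specialize σ μ p ∈ Ideal.span {specialize σ μ (poly K), X 2 ^ m, X 3 ^ m} := by
  have := Ideal.mem_map_of_mem (specialize σ μ) hp
  rw [Ideal.map_span] at this
  simpa [Set.image_insert_eq, specialize] using this

/-- A multiplier of `s ^ k * witness` into `(x^m, y^m)` vanishes at the origin. -/
theorem mem_maxIdeal_of_mul_witness_mem {g : R K} {n m k : ℕ} (hn : 2 ≤ n) (hm : n ≤ m)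
    (hg : g * (s K ^ k * witness (u K) (v K) (x K) (y K) n m) ∈
      Ideal.span {x K ^ m, y K ^ m}) : g ∈ maxIdeal K := by
  obtain ⟨p, rfl⟩ := Ideal.Quotient.mk_surjective g
  obtain ⟨μ, hμ⟩ := exists_recSeq_eq_zero K hn
  -- Keeping s as an indeterminate lets s^k be cancelled from the constant coefficient; setting it
  -- to 0 afterwards recovers the value at the origin.
  let L := Polynomial (AlgebraicClosure K)
  have hμ' : recSeq (1 : L) (-Polynomial.C μ) n = 0 := by
    have := congrArg (Polynomial.C) hμ
    rw [map_recSeq] at this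
    simpa using this
  have h := constantCoeff_specialize_eq_zero (p := p * X 0 ^ k) (σ := (Polynomial.X : L))
    (μ := Polynomial.C μ) (by omega) hm hμ' (specialize_mem (exists_lift_relation hg (by
      simp [witness, s, u, v, x, y, var]; ring)))
  have h' : constantCoeff (specialize (Polynomial.X : L) (Polynomial.C μ) p) = 0 := by
    simpa [specialize] using h
  have hcomp : (((Polynomial.evalRingHom (0 : AlgebraicClosure K)).comp constantCoeff).comp
      (specialize (Polynomial.X : L) (Polynomial.C μ))) =
      (algebraMap K (AlgebraicClosure K)).comp constantCoeff := by
    apply ringHom_ext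
    · intro r
      simp [specialize]
    · intro i
      fin_cases i <;> simp [specialize]
  have h0 := RingHom.congr_fun hcomp p
  simp only [RingHom.comp_apply, h', map_zero] at h0
  rw [maxIdeal_eq_ker, RingHom.mem_ker]
  simpa [evalZero] using h0.symm

theorem pow_mul_witness_notMem_R {n m : ℕ} (k : ℕ) (hn : 2 ≤ n) (hm : n ≤ m) :
    s K ^ k * witness (u K) (v K) (x K) (y K) n m ∉ Ideal.span {x K ^ m, y K ^ m} := fun h =>
  (maxIdeal_isPrime K).ne_top ((Ideal.eq_top_iff_one _).2
    (mem_maxIdeal_of_mul_witness_mem hn hm (by rwa [one_mul])))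

theorem pow_mul_witness_notMem_Loc {n m : ℕ} (k : ℕ) (hn : 2 ≤ n) (hm : n ≤ m) :
    toLoc K (s K) ^ k *
      witness (toLoc K (u K)) (toLoc K (v K)) (toLoc K (x K)) (toLoc K (y K)) n m ∉
      Ideal.span {toLoc K (x K) ^ m, toLoc K (y K) ^ m} := by
  intro h
  have h₁ := pow_mul_map_witness (B := Loc K) (toLoc K) (s K) (u K) (v K) (x K) (y K) k n m
  have h₂ := span_map_pow_pair (B := Loc K) (toLoc K) (x K) (y K) m
  replace h := Eq.mp (congrArg₂ (fun a I => a ∈ I) h₁ h₂) h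
  rw [
    -- Membership after localization amounts to membership in R after multiplication by some g
    -- outside 𝔪.
    IsLocalization.algebraMap_mem_map_algebraMap_iff (maxIdeal K).primeCompl] at h
  obtain ⟨g, hg, h⟩ := h
  exact hg (mem_maxIdeal_of_mul_witness_mem hn hm h)

theorem pow_mul_witness_notMem_Spec1 {n m : ℕ} (k : ℕ) (hn : 2 ≤ n) (hm : n ≤ m) :
    toSpec1 K (s K) ^ k *
      witness (toSpec1 K (u K)) (toSpec1 K (v K)) (toSpec1 K (x K)) (toSpec1 K (y K)) n m ∉
      Ideal.span {toSpec1 K (x K) ^ m, toSpec1 K (y K) ^ m} := by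
  intro h
  have h₁ := pow_mul_map_witness (B := Spec1 K) (toSpec1 K) (s K) (u K) (v K) (x K) (y K) k n m
  have h₂ := span_map_pow_pair (B := Spec1 K) (toSpec1 K) (x K) (y K) m
  replace h := Eq.mp (congrArg₂ (fun a I => a ∈ I) h₁ h₂) h
  rw [ Ideal.mem_quotient_iff_mem_sup] at h
  obtain ⟨r, hr, q, hq, hrq⟩ := Submodule.mem_sup.1 h
  obtain ⟨q, rfl⟩ := Ideal.mem_span_singleton'.1 hq
  obtain ⟨q, rfl⟩ := Ideal.Quotient.mk_surjective q
  obtain ⟨μ, hμ⟩ := exists_recSeq_eq_zero K hn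
  -- Taking σ = 1 makes the multiple of s - 1 vanish.
  have hmem := specialize_mem (σ := (1 : AlgebraicClosure K)) (μ := μ)
    (exists_lift_relation hr (p := X 0 ^ k * (X 2 * X 4 * (X 3 * X 5) ^ (n - 1) *
      (X 4 * X 5) ^ (m - n)) - q * (X 0 - 1)) (by
      rw [eq_sub_of_add_eq hrq]
      simp [witness, s, u, v, x, y, var]))
  have hone : specialize (K := K) (1 : AlgebraicClosure K) μ (X 0 - 1) = 0 := by
    simp [specialize]
  rw [map_sub, map_mul (specialize (1 : AlgebraicClosure K) μ) q, hone, mul_zero, sub_zero] at hmem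
  have h := constantCoeff_specialize_eq_zero (by omega) hm hμ hmem
  simp [specialize] at h

end Witness

end DomainExample

theorem mainTheorem5 (K : Type w) [Field K] :
    -- `R` is a domain and `R_𝔪` is a local domain
    (IsDomain (DomainExample.R K) ∧
      IsDomain (DomainExample.Loc K) ∧ IsLocalRing (DomainExample.Loc K)) ∧
    -- `H²_{(x,y)}` has infinitely many associated primes for `R`, `R_𝔪` and `R/(s-1)`
    ((DomainExample.assH2 (DomainExample.x K) (DomainExample.y K)).Infinite ∧
      (DomainExample.assH2
        (DomainExample.toLoc K (DomainExample.x K))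
        (DomainExample.toLoc K (DomainExample.y K))).Infinite ∧
      (DomainExample.assH2
        (DomainExample.toSpec1 K (DomainExample.x K))
        (DomainExample.toSpec1 K (DomainExample.y K))).Infinite) ∧
    -- generalized Frobenius powers of `(x,y)` in `R`, `R_𝔪` and `R/(s-1)`
    (∀ S : Set ℕ, (∀ m ∈ S, 0 < m) → S.Infinite →
      (⋃ m ∈ S, DomainExample.assPow (DomainExample.x K) (DomainExample.y K) m).Infinite ∧
      (⋃ m ∈ S, DomainExample.assPow
        (DomainExample.toLoc K (DomainExample.x K))
        (DomainExample.toLoc K (DomainExample.y K)) m).Infinite ∧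
      (⋃ m ∈ S, DomainExample.assPow
        (DomainExample.toSpec1 K (DomainExample.x K))
        (DomainExample.toSpec1 K (DomainExample.y K)) m).Infinite) ∧
    -- Frobenius powers of `(x,y)` when `K` has characteristic `p > 0`
    (∀ p : ℕ, 0 < p → CharP K p →
      (⋃ e : ℕ, DomainExample.assPow (DomainExample.x K) (DomainExample.y K) (p ^ e)).Infinite ∧
      (⋃ e : ℕ, DomainExample.assPow
        (DomainExample.toLoc K (DomainExample.x K))
        (DomainExample.toLoc K (DomainExample.y K))
        (p ^ e)).Infinite ∧
      (⋃ e : ℕ, DomainExample.assPow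
        (DomainExample.toSpec1 K (DomainExample.x K))
        (DomainExample.toSpec1 K (DomainExample.y K))
        (p ^ e)).Infinite) := by
  have noethLoc : IsNoetherianRing (DomainExample.Loc K) :=
    IsLocalization.isNoetherianRing (DomainExample.maxIdeal K).primeCompl _ inferInstance
  have relR := DomainExample.relation_R K
  have relLoc := DomainExample.relation_map K (B := DomainExample.Loc K) (DomainExample.toLoc K)
  have relSpec := DomainExample.relation_map K (B := DomainExample.Spec1 K) (DomainExample.toSpec1 K)
  have nR := fun n m k => DomainExample.pow_mul_witness_notMem_R (K := K) (n := n) (m := m) k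
  have nLoc := fun n m k => DomainExample.pow_mul_witness_notMem_Loc (K := K) (n := n) (m := m) k
  have nSpec := fun n m k =>
    DomainExample.pow_mul_witness_notMem_Spec1 (K := K) (n := n) (m := m) k
  have hpow : ∀ S : Set ℕ, S.Infinite → _ ∧ _ ∧ _ := fun S hS =>
    ⟨DomainExample.infinite_assPow relR nR hS, DomainExample.infinite_assPow relLoc nLoc hS,
      DomainExample.infinite_assPow relSpec nSpec hS⟩
  refine ⟨⟨inferInstance, inferInstance, inferInstance⟩,
    ⟨DomainExample.infinite_assH2 relR nR, DomainExample.infinite_assH2 relLoc nLoc,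
      DomainExample.infinite_assH2 relSpec nSpec⟩, fun S _ hS => hpow S hS, fun p hp hchar => ?_⟩
  have hprime : p.Prime := (CharP.char_is_prime_or_zero K p).resolve_right hp.ne'
  have := hpow _ (Set.infinite_range_of_injective (Nat.pow_right_injective hprime.two_le))
  simpa only [Set.biUnion_range] using this
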